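/- Let $\Omega\subset\mathbb{R}^n$ be nonempty, closed and convex, and let $F:\Omega\to\mathbb{R}^n$ be continuous and monotone, i.e. $\langle F(x)-F(y),x-y\rangle\ge 0$ for all $x,y\in\Omega$. Assume that $F$ is coercive with respect to $\Omega$: for every $x_0\in\Omega$ there is $\gamma>0$ with $$\liminf_{\|x\|\to\infty,\ x\in\Omega}\frac{\langle F(x),x-x_0\rangle}{\|x\|^{\gamma}}>0$$ (the lower limit being $+\infty$ if $\Omega$ is bounded). Let $\varphi:\Omega\to\mathbb{R}$ be strongly convex, i.e. for some $\rho>0$, $\varphi(tx+(1-t)y)\le t\varphi(x)+(1-t)\varphi(y)-\tfrac{\rho}{2}t(1-t)\|x-y\|^2$ for all $x,y\in\Omega$, $t\in[0,1]$, and Fréchet differentiable on $\Omega$ with gradient $\nabla\varphi:\Omega\to\mathbb{R}^n$, i.e. $\varphi(y)=\varphi(x)+\langle\nabla\varphi(x),y-x\rangle+o(\|y-x\|)$ as $y\to x$ in $\Omega$, for every $x\in\Omega$ (for instance, the restriction to $\Omega$ of the usual gradient of a function differentiable on $\mathbb{R}^n$). Then for every $\varepsilon>0$ the variational inequality $\mathrm{VI}(F+\varepsilon\nabla\varphi,\Omega)$,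 that is, to find $x\in\Omega$ with $$\langle F(x)+\varepsilon\nabla\varphi(x),\,y-x\rangle\ge 0\qquad\text{for all } y\in\Omega,$$ has exactly one solution $x_\varepsilon$, and the map $(0,\infty)\to\mathbb{R}^n$, $\varepsilon\mapsto x_\varepsilon$, is continuous. -/

import Mathlib

/-- The solution set of the variational inequality `VI(T, Ω)`: the points `x ∈ Ω` with
`⟨T x, y - x⟩ ≥ 0` for all `y ∈ Ω`. Only the values of `T` on `Ω` matter. -/
def viSol {n : ℕ} (T : EuclideanSpace ℝ (Fin n) → EuclideanSpace ℝ (Fin n))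
    (Ω : Set (EuclideanSpace ℝ (Fin n))) : Set (EuclideanSpace ℝ (Fin n)) :=
  {x | x ∈ Ω ∧ ∀ y ∈ Ω, 0 ≤ inner ℝ (T x) (y - x)}

/-- `F` is monotone on `Ω` in the sense of operators: `⟨F x - F y, x - y⟩ ≥ 0` on `Ω`. -/
def IsMonotoneMapOn {n : ℕ} (F : EuclideanSpace ℝ (Fin n) → EuclideanSpace ℝ (Fin n))
    (Ω : Set (EuclideanSpace ℝ (Fin n))) : Prop :=
  ∀ x ∈ Ω, ∀ y ∈ Ω, 0 ≤ inner ℝ (F x - F y) (x - y)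

/-- `F` is coercive with respect to `Ω`: for every `x₀ ∈ Ω` there is `γ > 0` such that
`liminf ⟨F x, x - x₀⟩ / ‖x‖ ^ γ > 0` as `‖x‖ → ∞` with `x ∈ Ω`. The lower limit is taken in the
extended reals, so it is `+∞` (and the condition holds) when `Ω` is bounded. -/
def IsCoerciveMapOn {n : ℕ} (F : EuclideanSpace ℝ (Fin n) → EuclideanSpace ℝ (Fin n))
    (Ω : Set (EuclideanSpace ℝ (Fin n))) : Prop :=
  ∀ x₀ ∈ Ω, ∃ γ : ℝ, 0 < γ ∧
    (0 : EReal) < Filter.liminf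
      (fun x => ((inner ℝ (F x) (x - x₀) / ‖x‖ ^ γ : ℝ) : EReal))
      (Bornology.cobounded (EuclideanSpace ℝ (Fin n)) ⊓ Filter.principal Ω)

open Filter Topology

/-! Existence goes through a Minty form that keeps `φ` itself: `⟨F y, x - y⟩ + ε (φ x - φ y) ≤ 0`
for all `y ∈ Ω`. For each `y` the solutions form a compact set, by the quadratic growth of `φ`;
finitely many such sets meet, by a matrix alternative fed by monotonicity; a limit along segments
then recovers the variational inequality. Uniqueness and continuity both follow from one estimate,
`norm_sub_le_of_mem_viSol`, a consequence of strong monotonicity of the gradient. -/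

/-- A matrix with nonpositive symmetric part maps some probability vector to a nonpositive
vector. -/
theorem exists_stdSimplex_sum_mul_nonpos {ι : Type*} [Fintype ι] [Nonempty ι] (A : ι → ι → ℝ)
    (hA : ∀ i j, A i j + A j i ≤ 0) :
    ∃ p ∈ stdSimplex ℝ ι, ∀ i, ∑ j, A i j * p j ≤ 0 := by
  classical
  by_contra! hcon
  let L : (ι → ℝ) →ₗ[ℝ] (ι → ℝ) := Matrix.mulVecLin (Matrix.of A)
  have hL : ∀ p i, L p i = ∑ j, A i j * p j := fun p i ↦ rfl
  have hdisj : Disjoint (L '' stdSimplex ℝ ι) (Set.Iic 0) := by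
    rw [Set.disjoint_left]
    rintro _ ⟨p, hp, rfl⟩ hle
    obtain ⟨i, hi⟩ := hcon p hp
    exact absurd (hle i) (not_le.2 (by rw [hL]; exact hi))
  obtain ⟨f, u, v, hfu, huv, hfv⟩ := geometric_hahn_banach_compact_closed
    ((convex_stdSimplex ℝ ι).linear_image L)
    ((isCompact_stdSimplex (𝕜 := ℝ) (ι := ι)).image L.continuous_of_finiteDimensional)
    (convex_Iic 0) isClosed_Iic hdisj
  have hv : v < 0 := by simpa using hfv 0 (by simp)
  let μ : ι → ℝ := fun i ↦ -f (Pi.single i 1)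
  have hf : ∀ b, f b = -∑ i, μ i * b i := by
    intro b
    conv_lhs => rw [← Finset.univ_sum_single b]
    rw [map_sum, ← Finset.sum_neg_distrib]
    refine Finset.sum_congr rfl fun i _ ↦ ?_
    have : (Pi.single i (b i) : ι → ℝ) = b i • Pi.single i 1 := by
      rw [← Pi.single_smul, smul_eq_mul, mul_one]
    rw [this, map_smul, smul_eq_mul]
    simp only [μ]
    ring
  have hμ : ∀ i, 0 ≤ μ i := by
    intro i
    by_contra! hneg
    -- If `μ i < 0`, this point of the nonpositive orthant is scaled so that `f` takes exactly the
    -- forbidden value `v`.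
    have h := hfv (-((v / μ i) • Pi.single i 1)) (by
      intro j
      have : 0 ≤ v / μ i := (div_pos_of_neg_of_neg hv hneg).le
      by_cases hj : j = i
      · subst hj; simpa using this
      · simp [hj])
    rw [map_neg, map_smul, smul_eq_mul, ← mul_neg] at h
    change v < v / μ i * μ i at h
    rw [div_mul_cancel₀ _ hneg.ne] at h
    exact lt_irrefl _ h
  have hpos : ∀ p ∈ stdSimplex ℝ ι, 0 < ∑ i, μ i * L p i := by
    intro p hp
    have h := hfu _ (Set.mem_image_of_mem L hp)
    rw [hf] at h
    linarith
  have hm : 0 < ∑ i, μ i := by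
    refine (Finset.sum_nonneg fun i _ ↦ hμ i).lt_of_ne' fun h0 ↦ ?_
    have h := (Finset.sum_eq_zero_iff_of_nonneg fun i _ ↦ hμ i).1 h0
    have h1 := hpos _ (single_mem_stdSimplex ℝ (Classical.arbitrary ι))
    rw [Finset.sum_eq_zero fun i hi ↦ by rw [h i hi, zero_mul]] at h1
    exact lt_irrefl _ h1
  set m := ∑ i, μ i with hm_def
  -- Testing at `μ` normalized gives `μᵀAμ > 0`, which the sign of the symmetric part forbids.
  have hq := hpos (fun i ↦ μ i / m) ⟨fun i ↦ div_nonneg (hμ i) hm.le, by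
    rw [← Finset.sum_div, div_self hm.ne']⟩
  have hS : ∑ i, μ i * L (fun i ↦ μ i / m) i = (∑ i, ∑ j, μ i * μ j * A i j) / m := by
    rw [Finset.sum_div]
    refine Finset.sum_congr rfl fun i _ ↦ ?_
    rw [hL, Finset.mul_sum, Finset.sum_div]
    exact Finset.sum_congr rfl fun j _ ↦ by ring
  rw [hS, lt_div_iff₀ hm, zero_mul] at hq
  have hT : 2 * ∑ i, ∑ j, μ i * μ j * A i j = ∑ i, ∑ j, μ i * μ j * (A i j + A j i) := by
    rw [two_mul]
    nth_rewrite 2 [Finset.sum_comm]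
    simp_rw [← Finset.sum_add_distrib]
    exact Finset.sum_congr rfl fun i _ ↦ Finset.sum_congr rfl fun j _ ↦ by ring
  have hU : ∑ i, ∑ j, μ i * μ j * (A i j + A j i) ≤ 0 :=
    Finset.sum_nonpos fun i _ ↦ Finset.sum_nonpos fun j _ ↦
      mul_nonpos_of_nonneg_of_nonpos (mul_nonneg (hμ i) (hμ j)) (hA i j)
  linarith

section InnerProductSpace

variable {E : Type*} [NormedAddCommGroup E] [InnerProductSpace ℝ E] {s : Set E}

/-- The segment from a point of a convex set towards another one stays in the set near `0`. -/
theorem Convex.eventually_add_smul_sub_mem (hs : Convex ℝ s) {x y : E} (hx : x ∈ s) (hy : y ∈ s) :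
    ∀ᶠ t : ℝ in 𝓝[>] 0, x + t • (y - x) ∈ s := by
  filter_upwards [Ioc_mem_nhdsGT (zero_lt_one' ℝ)] with t ht
  exact hs.add_smul_sub_mem hx hy ⟨ht.1.le, ht.2⟩

theorem tendsto_add_smul_nhdsGT_zero (x v : E) :
    Tendsto (fun t : ℝ ↦ x + t • v) (𝓝[>] 0) (𝓝 x) := by
  have h : Continuous fun t : ℝ ↦ x + t • v := by fun_prop
  simpa using (h.tendsto 0).mono_left nhdsWithin_le_nhds

/-- One-sided directional derivatives of a function with a gradient within a convex set. -/
theorem HasGradientWithinAt.tendsto_slope_segment [CompleteSpace E] {f : E → ℝ} {g x y : E}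
    (hf : HasGradientWithinAt f g s x) (hs : Convex ℝ s) (hx : x ∈ s) (hy : y ∈ s) :
    Tendsto (fun t : ℝ ↦ t⁻¹ * (f (x + t • (y - x)) - f x)) (𝓝[>] 0) (𝓝 (inner ℝ g (y - x))) := by
  have h := hf.hasFDerivWithinAt.lim (l := 𝓝[>] (0 : ℝ)) (c := fun t ↦ t⁻¹)
    (d := fun t ↦ t • (y - x)) (v := y - x)
    (by simpa using tendsto_add_smul_nhdsGT_zero 0 (y - x))
    (hs.eventually_add_smul_sub_mem hx hy)
    (tendsto_const_nhds.congr' (by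
      filter_upwards [self_mem_nhdsWithin] with t ht
      rw [inv_smul_smul₀ (ne_of_gt ht)]))
  simpa using h

/-- The first-order lower bound of a strongly convex function. -/
theorem StrongConvexOn.add_inner_add_le [CompleteSpace E] {f : E → ℝ} {m : ℝ} {g x y : E}
    (hf : StrongConvexOn s m f) (hg : HasGradientWithinAt f g s x) (hx : x ∈ s) (hy : y ∈ s) :
    f x + inner ℝ g (y - x) + m / 2 * ‖y - x‖ ^ 2 ≤ f y := by
  have hlim : Tendsto (fun t : ℝ ↦ f y - f x - (1 - t) * (m / 2 * ‖y - x‖ ^ 2)) (𝓝[>] 0)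
      (𝓝 (f y - f x - m / 2 * ‖y - x‖ ^ 2)) := by
    have h : Continuous fun t : ℝ ↦ f y - f x - (1 - t) * (m / 2 * ‖y - x‖ ^ 2) := by fun_prop
    simpa using (h.tendsto 0).mono_left nhdsWithin_le_nhds
  have h := le_of_tendsto_of_tendsto (hg.tendsto_slope_segment hf.1 hx hy) hlim (by
    filter_upwards [Ioc_mem_nhdsGT (zero_lt_one' ℝ)] with t ht
    have h := hf.2 hy hx ht.1.le (sub_nonneg.2 ht.2) (by ring)
    have hxy : t • y + (1 - t) • x = x + t • (y - x) := by module
    rw [hxy] at h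
    simp only [smul_eq_mul] at h
    rw [inv_mul_le_iff₀ ht.1]
    linarith)
  linarith

/-- Gradients of a strongly convex function are strongly monotone. -/
theorem StrongConvexOn.mul_norm_sq_le_inner_sub [CompleteSpace E] {f : E → ℝ} {m : ℝ}
    {g : E → E} {x y : E} (hf : StrongConvexOn s m f)
    (hg : ∀ x ∈ s, HasGradientWithinAt f (g x) s x) (hx : x ∈ s) (hy : y ∈ s) :
    m * ‖x - y‖ ^ 2 ≤ inner ℝ (g x - g y) (x - y) := by
  have h1 := hf.add_inner_add_le (hg x hx) hx hy
  have h2 := hf.add_inner_add_le (hg y hy) hy hx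
  rw [← neg_sub x y, inner_neg_right, norm_neg] at h1
  rw [inner_sub_left]
  linarith

end InnerProductSpace

section VariationalInequality

variable {n : ℕ} {Ω : Set (EuclideanSpace ℝ (Fin n))}
  {F g : EuclideanSpace ℝ (Fin n) → EuclideanSpace ℝ (Fin n)}
  {φ : EuclideanSpace ℝ (Fin n) → ℝ} {ρ ε δ : ℝ}

/-- Finitely many of the Minty inequalities of a monotone map perturbed by a convex function have
a common solution. -/
theorem IsMonotoneMapOn.exists_finset_minty (hF : IsMonotoneMapOn F Ω) (hφ : ConvexOn ℝ Ω φ)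
    (hε : 0 ≤ ε) (u : Finset Ω) (hu : u.Nonempty) :
    ∃ x ∈ Ω, ∀ y ∈ u, inner ℝ (F y) (x - y) + ε * (φ x - φ y) ≤ 0 := by
  have : Nonempty u := hu.to_subtype
  let z : u → EuclideanSpace ℝ (Fin n) := fun i ↦ i.1.1
  have hz : ∀ i, z i ∈ Ω := fun i ↦ i.1.2
  -- In `A i j + A j i` the `φ` terms cancel and monotonicity of `F` gives the sign.
  obtain ⟨p, hp, hle⟩ := exists_stdSimplex_sum_mul_nonpos
    (fun i j : u ↦ inner ℝ (F (z i)) (z j - z i) + ε * (φ (z j) - φ (z i))) (by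
      intro i j
      have h := hF _ (hz i) _ (hz j)
      rw [← neg_sub (z i) (z j), inner_neg_right]
      rw [inner_sub_left] at h
      linarith)
  refine ⟨∑ j, p j • z j,
    hφ.1.sum_mem (fun j _ ↦ hp.1 j) hp.2 fun j _ ↦ hz j, fun y hy ↦ ?_⟩
  have hJ := hφ.map_sum_le (t := Finset.univ) (w := p) (p := z) (fun j _ ↦ hp.1 j) hp.2
    fun j _ ↦ hz j
  simp only [smul_eq_mul] at hJ
  have h := hle ⟨y, hy⟩
  have hsum : ∑ j, (inner ℝ (F y) (z j - y) + ε * (φ (z j) - φ y)) * p j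
      = inner ℝ (F y) (∑ j, p j • z j - y) + ε * (∑ j, p j * φ (z j) - φ y) := by
    have hy1 : (inner ℝ (F y) (y : EuclideanSpace ℝ (Fin n)) : ℝ)
        = ∑ j, inner ℝ (F y) (y : EuclideanSpace ℝ (Fin n)) * p j := by
      rw [← Finset.mul_sum, hp.2, mul_one]
    have hy2 : φ y = ∑ j, φ y * p j := by rw [← Finset.mul_sum, hp.2, mul_one]
    rw [inner_sub_right, inner_sum, hy1, ← Finset.sum_sub_distrib]
    nth_rewrite 2 [hy2]
    rw [← Finset.sum_sub_distrib, Finset.mul_sum, ← Finset.sum_add_distrib]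
    refine Finset.sum_congr rfl fun j _ ↦ ?_
    rw [inner_sub_right, real_inner_smul_right]
    ring
  have h' : ∑ j, (inner ℝ (F y) (z j - y) + ε * (φ (z j) - φ y)) * p j ≤ 0 := h
  rw [hsum] at h'
  have := mul_le_mul_of_nonneg_left hJ hε
  linarith

/-- The Minty inequality at a fixed point has a compact set of solutions. -/
theorem StrongConvexOn.isCompact_minty (hcl : IsClosed Ω) (hφ : StrongConvexOn Ω ρ φ) (hρ : 0 < ρ)
    (hg : ∀ x ∈ Ω, HasGradientWithinAt φ (g x) Ω x) (hε : 0 < ε)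
    {y : EuclideanSpace ℝ (Fin n)} (hy : y ∈ Ω) (w : EuclideanSpace ℝ (Fin n)) :
    IsCompact {x | x ∈ Ω ∧ inner ℝ w (x - y) + ε * (φ x - φ y) ≤ 0} := by
  have hφc : ContinuousOn φ Ω := fun x hx ↦ (hg x hx).continuousWithinAt
  refine Metric.isCompact_of_isClosed_isBounded ?_ ?_
  · exact (ContinuousOn.add (by fun_prop) (continuousOn_const.mul
      (hφc.sub continuousOn_const))).preimage_isClosed_of_isClosed hcl isClosed_Iic
  -- The radius comes from the first-order bound at `y`: `ε ρ/2 ‖x - y‖² ≤ -⟨w + ε g y, x - y⟩`,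
  -- then Cauchy-Schwarz.
  · refine (Metric.isBounded_closedBall (x := y)
      (r := ‖w + ε • g y‖ / (ε * (ρ / 2)))).subset ?_
    rintro x ⟨hx, hle⟩
    rw [Metric.mem_closedBall, dist_eq_norm, le_div_iff₀ (by positivity)]
    have h1 := mul_le_mul_of_nonneg_left (hφ.add_inner_add_le (hg y hy) hy hx) hε.le
    have h2 := neg_le_of_abs_le (abs_real_inner_le_norm (w + ε • g y) (x - y))
    rw [inner_add_left, real_inner_smul_left] at h2
    rcases (norm_nonneg (x - y)).eq_or_lt with h0 | h0
    · rw [← h0, zero_mul]; exact norm_nonneg _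
    · refine le_of_mul_le_mul_right ?_ h0
      linarith

/-- Solutions of the Minty inequalities solve the variational inequality. -/
theorem mem_viSol_of_minty (hconv : Convex ℝ Ω) (hF : ContinuousOn F Ω)
    (hg : ∀ x ∈ Ω, HasGradientWithinAt φ (g x) Ω x) {x : EuclideanSpace ℝ (Fin n)} (hx : x ∈ Ω)
    (h : ∀ y ∈ Ω, inner ℝ (F y) (x - y) + ε * (φ x - φ y) ≤ 0) :
    x ∈ viSol (fun x ↦ F x + ε • g x) Ω := by
  refine ⟨hx, fun y hy ↦ ?_⟩
  have hmem := hconv.eventually_add_smul_sub_mem hx hy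
  have hFlim : Tendsto (fun t : ℝ ↦ F (x + t • (y - x))) (𝓝[>] 0) (𝓝 (F x)) :=
    (hF x hx).tendsto.comp
      (tendsto_nhdsWithin_iff.2 ⟨tendsto_add_smul_nhdsGT_zero x (y - x), hmem⟩)
  have hlim := (hFlim.inner (𝕜 := ℝ) (tendsto_const_nhds (x := y - x))).add
    (((hg x hx).tendsto_slope_segment hconv hx hy).const_mul ε)
  rw [inner_add_left, real_inner_smul_left]
  refine ge_of_tendsto hlim ?_
  filter_upwards [hmem, self_mem_nhdsWithin] with t htmem ht
  have ht : 0 < t := ht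
  -- Minty's trick: test at `x + t (y - x)`, divide by `t` and let `t → 0⁺`.
  have h1 := h _ htmem
  rw [sub_add_cancel_left, inner_neg_right, real_inner_smul_right] at h1
  refine nonneg_of_mul_nonneg_right (a := t) ?_ ht
  have : t * (ε * (t⁻¹ * (φ (x + t • (y - x)) - φ x))) = ε * (φ (x + t • (y - x)) - φ x) := by
    field_simp
  rw [mul_add, this]
  linarith

theorem viSol_add_smul_gradient_nonempty (hne : Ω.Nonempty) (hcl : IsClosed Ω)
    (hFc : ContinuousOn F Ω) (hF : IsMonotoneMapOn F Ω) (hφ : StrongConvexOn Ω ρ φ) (hρ : 0 < ρ)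
    (hg : ∀ x ∈ Ω, HasGradientWithinAt φ (g x) Ω x) (hε : 0 < ε) :
    (viSol (fun x ↦ F x + ε • g x) Ω).Nonempty := by
  classical
  obtain ⟨x₀, hx₀⟩ := hne
  have hφ0 : ConvexOn ℝ Ω φ := strongConvexOn_zero.1 (hφ.mono hρ.le)
  let G : Ω → Set (EuclideanSpace ℝ (Fin n)) := fun y ↦
    {x | x ∈ Ω ∧ inner ℝ (F y) (x - y) + ε * (φ x - φ y) ≤ 0}
  have hG : ∀ y, IsCompact (G y) := fun y ↦ hφ.isCompact_minty hcl hρ hg hε y.2 (F y)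
  obtain ⟨x, hx, hxG⟩ := (hG ⟨x₀, hx₀⟩).inter_iInter_nonempty G (fun y ↦ (hG y).isClosed)
    fun u ↦ by
      -- Inserting `x₀` makes the family nonempty and puts the common point in the compact set `G
      -- x₀`.
      obtain ⟨x, hx, h⟩ := hF.exists_finset_minty hφ0 hε.le (insert ⟨x₀, hx₀⟩ u)
        (Finset.insert_nonempty _ _)
      exact ⟨x, ⟨hx, h _ (Finset.mem_insert_self _ _)⟩,
        Set.mem_iInter₂.2 fun y hy ↦ ⟨hx, h y (Finset.mem_insert_of_mem hy)⟩⟩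
  exact ⟨x, mem_viSol_of_minty hφ.1 hFc hg hx.1 fun y hy ↦ (Set.mem_iInter.1 hxG ⟨y, hy⟩).2⟩

/-- Dependence of the solutions on the regularization parameter. -/
theorem norm_sub_le_of_mem_viSol (hF : IsMonotoneMapOn F Ω) (hφ : StrongConvexOn Ω ρ φ)
    (hρ : 0 < ρ) (hg : ∀ x ∈ Ω, HasGradientWithinAt φ (g x) Ω x) (hε : 0 < ε)
    {x y : EuclideanSpace ℝ (Fin n)} (hx : x ∈ viSol (fun x ↦ F x + ε • g x) Ω)
    (hy : y ∈ viSol (fun x ↦ F x + δ • g x) Ω) :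
    ‖x - y‖ ≤ |ε - δ| * ‖g y‖ / (ε * ρ) := by
  rw [le_div_iff₀ (by positivity)]
  have h1 := hx.2 y hy.1
  have h2 := hy.2 x hx.1
  have h3 := hF x hx.1 y hy.1
  have h4 := mul_le_mul_of_nonneg_left (hφ.mul_norm_sq_le_inner_sub hg hx.1 hy.1) hε.le
  rw [← neg_sub x y, inner_neg_right] at h1
  simp only [inner_add_left, real_inner_smul_left, inner_sub_left] at h1 h2 h3 h4
  -- Adding the two variational inequalities leaves `ε ρ ‖x - y‖² ≤ (δ - ε) ⟨g y, x - y⟩`.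
  have h5 : (δ - ε) * inner ℝ (g y) (x - y) ≤ |ε - δ| * (‖g y‖ * ‖x - y‖) := by
    refine (le_abs_self _).trans ?_
    rw [abs_mul, abs_sub_comm]
    gcongr
    exact abs_real_inner_le_norm _ _
  rcases (norm_nonneg (x - y)).eq_or_lt with h0 | h0
  · rw [← h0, zero_mul]; positivity
  · refine le_of_mul_le_mul_right ?_ h0
    linarith

end VariationalInequality

/-- `Ω` is a nonempty closed convex set, `F` is continuous, monotone and coercive on `Ω`, and `φ`
is strongly convex and Fréchet differentiable on `Ω` with gradient `gradφ` (if `φ` is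
differentiable in the whole space, `gradφ` may be the usual gradient). -/
theorem mainTheorem11 {n : ℕ} (Ω : Set (EuclideanSpace ℝ (Fin n)))
    (hΩne : Ω.Nonempty) (hΩcl : IsClosed Ω) (hΩconv : Convex ℝ Ω)
    (F : EuclideanSpace ℝ (Fin n) → EuclideanSpace ℝ (Fin n))
    (hFcont : ContinuousOn F Ω) (hFmono : IsMonotoneMapOn F Ω) (hFcoer : IsCoerciveMapOn F Ω)
    (φ : EuclideanSpace ℝ (Fin n) → ℝ) (ρ : ℝ) (hρ : 0 < ρ) (hφconv : StrongConvexOn Ω ρ φ)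
    (gradφ : EuclideanSpace ℝ (Fin n) → EuclideanSpace ℝ (Fin n))
    (hφdiff : ∀ x ∈ Ω, HasGradientWithinAt φ (gradφ x) Ω x) :
    ∃ xsol : ℝ → EuclideanSpace ℝ (Fin n),
      (∀ ε : ℝ, 0 < ε → viSol (fun x => F x + ε • gradφ x) Ω = {xsol ε}) ∧
      ContinuousOn xsol (Set.Ioi 0) := by
  have hex : ∀ ε : ℝ, 0 < ε → (viSol (fun x => F x + ε • gradφ x) Ω).Nonempty := fun ε hε ↦
    viSol_add_smul_gradient_nonempty hΩne hΩcl hFcont hFmono hφconv hρ hφdiff hε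
  choose! xsol hxsol using hex
  refine ⟨xsol, fun ε hε ↦ ?_, fun δ hδ ↦ ?_⟩
  · refine Set.eq_singleton_iff_unique_mem.2 ⟨hxsol ε hε, fun x hx ↦ ?_⟩
    have h := norm_sub_le_of_mem_viSol hFmono hφconv hρ hφdiff hε hx (hxsol ε hε)
    simpa [sub_eq_zero] using h
  · have hδ : 0 < δ := hδ
    rw [ContinuousWithinAt, tendsto_iff_norm_sub_tendsto_zero]
    -- The bound involves the gradient only at the fixed point `xsol δ`, so continuity of `gradφ` is
    -- not needed.
    have hlim : Tendsto (fun ε : ℝ ↦ |ε - δ| * ‖gradφ (xsol δ)‖ / (ε * ρ)) (𝓝[Set.Ioi 0] δ)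
        (𝓝 0) := by
      have h : ContinuousAt (fun ε : ℝ ↦ |ε - δ| * ‖gradφ (xsol δ)‖ / (ε * ρ)) δ :=
        ContinuousAt.div (by fun_prop) (by fun_prop) (by positivity)
      simpa using h.tendsto.mono_left nhdsWithin_le_nhds
    refine squeeze_zero' (Eventually.of_forall fun _ ↦ norm_nonneg _) ?_ hlim
    filter_upwards [self_mem_nhdsWithin] with ε hε
    exact norm_sub_le_of_mem_viSol hFmono hφconv hρ hφdiff hε (hxsol ε hε) (hxsol δ hδ)
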